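/- Let $G$ be a finite group. A subgroup $H$ of $G$ is called abnormal if $g\in\langle H,g^{-1}Hg\rangle$ for all $g\in G$. Let $\Phi(G)$ be the Frattini subgroup of $G$, and let $\Delta(G)$ be the intersection of all abnormal maximal subgroups of $G$ (with $\Delta(G)=G$ if there are none). Let $Soc(G)$ be the subgroup generated by all minimal normal subgroups of $G$. Define the subgroups $\tilde F(G)$ and $\tilde F_\Delta(G)$ of $G$ by $$\Phi(G)\le\tilde F(G),\quad \tilde F(G)/\Phi(G)=Soc(G/\Phi(G));\qquad \Delta(G)\le\tilde F_\Delta(G),\quad \tilde F_\Delta(G)/\Delta(G)=Soc(G/\Delta(G)).$$ Then $\Delta(G)\le\tilde F(G)$, and $\tilde F(G/\Delta(G))=\tilde F(G)/\Delta(G)$ as subgroups of $G/\Delta(G)$. Moreover, $\tilde F_\Delta(G)=\tilde F(G)$. -/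

import Mathlib

namespace GenFitting

/-- A subgroup `H` of `G` is abnormal if `g ∈ ⟨H, H ^ g⟩` for all `g`, where `H ^ g = g⁻¹ H g`. -/
def IsAbnormal {G : Type*} [Group G] (H : Subgroup G) : Prop :=
  ∀ g : G, g ∈ H ⊔ H.map (MulAut.conj g⁻¹).toMonoidHom

/-- `Δ(G)`: the intersection of all abnormal maximal subgroups of `G`
(equal to `G` when there are none). -/
def delta (G : Type*) [Group G] : Subgroup G :=
  sInf {M : Subgroup G | IsCoatom M ∧ IsAbnormal M}

theorem IsAbnormal.comap_equiv {G : Type*} [Group G] {H : Subgroup G} (hH : IsAbnormal H)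
    (φ : G ≃* G) : IsAbnormal (H.comap φ.toMonoidHom) := by
  intro g
  have h := Subgroup.mem_map_of_mem φ.symm.toMonoidHom (hH (φ g))
  rw [Subgroup.map_sup, Subgroup.map_map] at h
  have h1 : H.comap φ.toMonoidHom = H.map φ.symm.toMonoidHom :=
    Subgroup.comap_equiv_eq_map_symm φ H
  rw [h1, Subgroup.map_map]
  have h2 : φ.symm.toMonoidHom.comp (MulAut.conj (φ g)⁻¹).toMonoidHom
      = (MulAut.conj g⁻¹).toMonoidHom.comp φ.symm.toMonoidHom := by
    ext x
    simp
  rw [h2] at h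
  simpa using h

/-- `Δ(G)` is normal, so that the quotient `G / Δ(G)` is a group. -/
instance delta_normal (G : Type*) [Group G] : (delta G).Normal := by
  refine ⟨fun n hn g => ?_⟩
  rw [delta, Subgroup.mem_sInf] at hn ⊢
  rintro M ⟨hM, hA⟩
  have hc : IsCoatom (M.comap (MulAut.conj g).toMonoidHom) :=
    Subgroup.isCoatom_comap_of_surjective (MulAut.conj g).surjective hM
  have h := hn _ ⟨hc, hA.comap_equiv (MulAut.conj g)⟩
  simpa [Subgroup.mem_comap] using h

/-- A minimal normal subgroup: minimal among the nontrivial normal subgroups of `G`. -/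
def IsMinimalNormal {G : Type*} [Group G] (N : Subgroup G) : Prop :=
  Minimal (fun K : Subgroup G => K.Normal ∧ K ≠ ⊥) N

/-- The socle: the subgroup generated by all minimal normal subgroups. -/
def socle (G : Type*) [Group G] : Subgroup G :=
  sSup {N : Subgroup G | IsMinimalNormal N}

/-- The subgroup `S` of `G` with `N ≤ S` and `S / N = Soc(G / N)`, that is, the full preimage of
`Soc(G / N)` under the quotient map. -/
def socleMod {G : Type*} [Group G] (N : Subgroup G) [N.Normal] : Subgroup G :=
  (socle (G ⧸ N)).comap (QuotientGroup.mk' N)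

/-- The generalized Fitting subgroup `F̃(G)`: `Φ(G) ≤ F̃(G)` and `F̃(G) / Φ(G) = Soc(G / Φ(G))`,
with `Φ(G)` the Frattini subgroup. -/
def tildeF (G : Type*) [Group G] : Subgroup G :=
  socleMod (frattini G)

/-- `F̃_Δ(G)`: `Δ(G) ≤ F̃_Δ(G)` and `F̃_Δ(G) / Δ(G) = Soc(G / Δ(G))`. -/
def tildeFDelta (G : Type*) [Group G] : Subgroup G :=
  socleMod (delta G)

end GenFitting

namespace GenFitting

open scoped commutatorElement

/-! A maximal subgroup that is not abnormal is normal with cyclic quotient, so it contains every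
commutator; hence [G, Δ(G)] ≤ Φ(G), that is, Δ(G)/Φ(G) is central in G/Φ(G)
(`commutator_mem_frattini`). In a finite Frattini-free group a central subgroup has a normal
complement, so factoring it out leaves the full preimage of the socle unchanged
(`comap_socle_of_ker_le_center`). Applied to G/Φ(G) → G/Δ(G), this gives F̃_Δ(G) = F̃(G). The other
two claims follow, the second because Φ(G/Δ(G)) = 1. -/

theorem IsMinimalNormal.exists_le {G : Type*} [Group G] [Finite G] {K : Subgroup G}
    (hK : K.Normal) (hne : K ≠ ⊥) : ∃ N ≤ K, IsMinimalNormal N := by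
  obtain ⟨N, hN, hmin⟩ := (Set.toFinite {L : Subgroup G | L.Normal ∧ L ≠ ⊥}).exists_le_minimal
    (show K ∈ {L : Subgroup G | L.Normal ∧ L ≠ ⊥} from ⟨hK, hne⟩)
  exact ⟨N, hN, hmin⟩

theorem IsMinimalNormal.map_eq_bot_or {G Q : Type*} [Group G] [Group Q] {f : G →* Q}
    (hf : Function.Surjective f) {N : Subgroup G} (hN : IsMinimalNormal N) :
    N.map f = ⊥ ∨ IsMinimalNormal (N.map f) := by
  by_cases h : N.map f = ⊥
  · exact Or.inl h
  refine Or.inr ⟨⟨hN.prop.1.map f hf, h⟩, ?_⟩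
  rintro K ⟨hKn, hK⟩ hle
  have hNn := hN.prop.1
  have hmap : (K.comap f ⊓ N).map f = K := by
    refine le_antisymm ((Subgroup.map_mono inf_le_left).trans (Subgroup.map_comap_le f K)) ?_
    intro k hk
    obtain ⟨n, hn, rfl⟩ := hle hk
    exact ⟨n, ⟨hk, hn⟩, rfl⟩
  have hne : K.comap f ⊓ N ≠ ⊥ := by
    intro hbot
    rw [hbot, Subgroup.map_bot] at hmap
    exact hK hmap.symm
  have hNle : N ≤ K.comap f ⊓ N := hN.le_of_le ⟨inferInstance, hne⟩ inf_le_right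
  exact (Subgroup.map_mono hNle).trans hmap.le

theorem map_socle_le {G Q : Type*} [Group G] [Group Q] {f : G →* Q}
    (hf : Function.Surjective f) : (socle G).map f ≤ socle Q := by
  rw [Subgroup.map_le_iff_le_comap]
  refine sSup_le fun N hN => ?_
  rw [← Subgroup.map_le_iff_le_comap]
  rcases IsMinimalNormal.map_eq_bot_or hf hN with h | h
  · rw [h]; exact bot_le
  · exact le_sSup h

theorem normal_of_le_center {G : Type*} [Group G] {A : Subgroup G}
    (hA : A ≤ Subgroup.center G) : A.Normal := by
  refine ⟨fun n hn g => ?_⟩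
  rwa [Subgroup.mem_center_iff.1 (hA hn) g, mul_inv_cancel_right]

theorem normal_of_sup_eq_top_of_le_center {G : Type*} [Group G] {A K : Subgroup G}
    (hA : A ≤ Subgroup.center G) (h : A ⊔ K = ⊤) : K.Normal := by
  have := normal_of_le_center hA
  refine ⟨fun n hn g => ?_⟩
  obtain ⟨a, ha, k, hk, rfl⟩ := Subgroup.mem_sup_of_normal_left.1
    (show g ∈ A ⊔ K from h ▸ Subgroup.mem_top g)
  have hc : a * (k * n * k⁻¹) * a⁻¹ = k * n * k⁻¹ := by
    rw [← Subgroup.mem_center_iff.1 (hA ha), mul_inv_cancel_right]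
  have he : a * k * n * (a * k)⁻¹ = k * n * k⁻¹ := by
    rw [← hc]; group
  rw [he]
  exact K.mul_mem (K.mul_mem hk hn) (K.inv_mem hk)

/-- If the Frattini subgroup is trivial, every central subgroup has a normal complement. -/
theorem exists_normal_isCompl_of_le_center {G : Type*} [Group G] [Finite G]
    (hG : frattini G = ⊥) {A : Subgroup G} (hA : A ≤ Subgroup.center G) :
    ∃ K : Subgroup G, K.Normal ∧ IsCompl A K := by
  -- A minimal supplement K works: if a maximal M missed A ⊓ K, then K ⊓ M would still supplement A,
  -- forcing K ≤ M.
  obtain ⟨K, -, hK⟩ := (Set.toFinite {L : Subgroup G | A ⊔ L = ⊤}).exists_le_minimal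
    (show (⊤ : Subgroup G) ∈ {L : Subgroup G | A ⊔ L = ⊤} from sup_top_eq A)
  have hAK : A ⊔ K = ⊤ := hK.prop
  refine ⟨K, normal_of_sup_eq_top_of_le_center hA hAK, ?_, codisjoint_iff.2 hAK⟩
  rw [disjoint_iff, eq_bot_iff, ← hG]
  refine le_iInf₂ fun M hM => ?_
  by_contra hB
  have hBn : (A ⊓ K).Normal := normal_of_le_center (inf_le_left.trans hA)
  have hBM : A ⊓ K ⊔ M = ⊤ := hM.2 _ (right_lt_sup.2 hB)
  have hK' : K ≤ A ⊔ (K ⊓ M) := by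
    intro k hk
    obtain ⟨b, hb, m, hm, rfl⟩ := Subgroup.mem_sup_of_normal_left.1
      (show k ∈ A ⊓ K ⊔ M from hBM ▸ Subgroup.mem_top k)
    refine Subgroup.mul_mem_sup hb.1 ⟨?_, hm⟩
    exact (K.mul_mem_cancel_left hb.2).1 hk
  have htop : A ⊔ (K ⊓ M) = ⊤ := by
    rw [eq_top_iff, ← hAK]
    exact sup_le le_sup_left hK'
  exact hB (inf_le_right.trans ((hK.le_of_le htop inf_le_left).trans inf_le_right))

/-- For K a normal complement of A ⊓ Soc(G), the normal subgroup A ⊓ K contains no minimal normal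
subgroup, so it is trivial and A = A ⊓ Soc(G). -/
theorem le_socle_of_le_center {G : Type*} [Group G] [Finite G]
    (hG : frattini G = ⊥) {A : Subgroup G} (hA : A ≤ Subgroup.center G) : A ≤ socle G := by
  obtain ⟨K, hKn, hdisj, hcod⟩ :=
    exists_normal_isCompl_of_le_center hG (A := A ⊓ socle G) (inf_le_left.trans hA)
  have hAn := normal_of_le_center hA
  have hSn := normal_of_le_center (A := A ⊓ socle G) (inf_le_left.trans hA)
  have hAK : A ⊓ K = ⊥ := by
    by_contra hne
    obtain ⟨N, hN, hmin⟩ := IsMinimalNormal.exists_le (inferInstance : (A ⊓ K).Normal) hne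
    exact hmin.prop.2 (eq_bot_iff.2 (hdisj
      (le_inf (hN.trans inf_le_left) (le_sSup hmin)) (hN.trans inf_le_right)))
  intro a ha
  obtain ⟨s, hs, k, hk, rfl⟩ := Subgroup.mem_sup_of_normal_left.1
    (show a ∈ A ⊓ socle G ⊔ K from hcod.eq_top ▸ Subgroup.mem_top a)
  have hk1 : k ∈ A ⊓ K := ⟨(A.mul_mem_cancel_left hs.1).1 ha, hk⟩
  rw [hAK, Subgroup.mem_bot] at hk1
  rw [hk1, mul_one]
  exact hs.2

/-- Quotients of a Frattini-free group by central subgroups preserve the socle. -/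
theorem comap_socle_of_ker_le_center {G Q : Type*} [Group G] [Finite G] [Group Q]
    (hG : frattini G = ⊥) {f : G →* Q} (hf : Function.Surjective f)
    (hker : f.ker ≤ Subgroup.center G) : (socle Q).comap f = socle G := by
  obtain ⟨K, hKn, hdisj, hcod⟩ := exists_normal_isCompl_of_le_center hG hker
  have hle : socle Q ≤ (socle G).map f := by
    refine sSup_le fun R (hR : IsMinimalNormal R) => ?_
    have hRn := hR.prop.1
    -- K complements the kernel, so `f` restricts to an isomorphism from K onto Q: R lifts into K,
    -- and nontrivial subgroups of K keep nontrivial images.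
    have hmap : R ≤ (R.comap f ⊓ K).map f := by
      intro r hr
      obtain ⟨g, rfl⟩ := hf r
      obtain ⟨d, hd, k, hk, rfl⟩ := Subgroup.mem_sup_of_normal_left.1
        (show g ∈ f.ker ⊔ K from hcod.eq_top ▸ Subgroup.mem_top g)
      have hdk : f (d * k) = f k := by rw [map_mul, MonoidHom.mem_ker.1 hd, one_mul]
      rw [hdk] at hr ⊢
      exact ⟨k, ⟨hr, hk⟩, rfl⟩
    have hne : R.comap f ⊓ K ≠ ⊥ := by
      intro hbot
      rw [hbot, Subgroup.map_bot] at hmap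
      exact hR.prop.2 (eq_bot_iff.2 hmap)
    obtain ⟨N, hN, hmin⟩ := IsMinimalNormal.exists_le inferInstance hne
    have hNmap : N.map f ≠ ⊥ := by
      rw [Ne, Subgroup.map_eq_bot_iff]
      intro h
      exact hmin.prop.2 (eq_bot_iff.2 (hdisj h (hN.trans inf_le_right)))
    have hNR : N.map f ≤ R :=
      Subgroup.map_le_iff_le_comap.2 (hN.trans inf_le_left)
    exact (hR.le_of_le ⟨hmin.prop.1.map f hf, hNmap⟩ hNR).trans
      (Subgroup.map_mono (le_sSup hmin))
  rw [le_antisymm hle (map_socle_le hf), Subgroup.comap_map_eq,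
    sup_eq_left.2 (le_socle_of_le_center hG hker)]

/-- If g ∉ ⟨M, M^g⟩, maximality forces M^g = M, so the normalizer of M contains g ∉ M and is all of
G. -/
theorem normal_of_isCoatom_of_not_isAbnormal {G : Type*} [Group G] {M : Subgroup G}
    (hM : IsCoatom M) (hA : ¬ IsAbnormal M) : M.Normal := by
  simp only [IsAbnormal, not_forall] at hA
  obtain ⟨g, hg⟩ := hA
  have hle : M.map (MulAut.conj g⁻¹).toMonoidHom ≤ M := by
    by_contra h
    exact hg (hM.2 _ (left_lt_sup.2 h) ▸ Subgroup.mem_top g)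
  have heq : M.map (MulAut.conj g⁻¹).toMonoidHom = M := by
    have hc : IsCoatom (M.map (MulAut.conj g⁻¹).toMonoidHom) :=
      ((MulAut.conj g⁻¹).mapSubgroup.isCoatom_iff M).2 hM
    exact (hc.le_iff_eq hM.1).1 hle |>.symm
  have hnorm : g⁻¹ ∈ Subgroup.normalizer (M : Set G) := by
    rw [Subgroup.mem_normalizer_iff]
    intro x
    constructor
    · intro hx
      rw [← heq]
      exact ⟨x, hx, rfl⟩
    · intro hx
      rw [← heq] at hx
      obtain ⟨y, hy, hyx⟩ := hx
      have hxy : y = x := (MulAut.conj g⁻¹).injective hyx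
      exact hxy ▸ hy
  have hlt : M < Subgroup.normalizer (M : Set G) := by
    refine lt_of_le_of_ne Subgroup.le_normalizer fun h => hg (Subgroup.mem_sup_left ?_)
    rw [← inv_mem_iff, h]
    exact hnorm
  exact Subgroup.normalizer_eq_top_iff.1 (hM.2 _ hlt)

/-- When d ∉ M, the quotient G/M is generated by the image of d, so that image commutes with
everything. -/
theorem commutator_mem_of_isCoatom_of_normal {G : Type*} [Group G] {M : Subgroup G}
    (hM : IsCoatom M) [M.Normal] (g d : G) : ⁅g, d⁆ ∈ M := by
  by_cases hd : d ∈ M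
  · exact Subgroup.commutator_le_right ⊤ M
      (Subgroup.commutator_mem_commutator (Subgroup.mem_top g) hd)
  have htop : M ⊔ Subgroup.zpowers d = ⊤ :=
    hM.2 _ (left_lt_sup.2 fun h => hd (h (Subgroup.mem_zpowers d)))
  obtain ⟨m, hm, z, hz, rfl⟩ := Subgroup.mem_sup_of_normal_left.1
    (show g ∈ M ⊔ Subgroup.zpowers d from htop ▸ Subgroup.mem_top g)
  obtain ⟨n, rfl⟩ := Subgroup.mem_zpowers_iff.1 hz
  rw [← QuotientGroup.eq_one_iff, ← QuotientGroup.mk'_apply, map_commutatorElement, map_mul,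
    QuotientGroup.mk'_apply, (QuotientGroup.eq_one_iff m).2 hm, one_mul, map_zpow,
    commutatorElement_eq_one_iff_commute]
  exact (Commute.refl _).zpow_left n

/-- `Δ(G) / Φ(G)` is central in `G / Φ(G)`. -/
theorem commutator_mem_frattini {G : Type*} [Group G] {d : G} (hd : d ∈ delta G) (g : G) :
    ⁅g, d⁆ ∈ frattini G := by
  refine (Subgroup.mem_iInf.2 fun M => Subgroup.mem_iInf.2 fun hM => ?_)
  by_cases hA : IsAbnormal M
  · have hle : delta G ≤ M := sInf_le ⟨hM, hA⟩
    exact hle (Subgroup.commutator_le_right ⊤ (delta G)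
      (Subgroup.commutator_mem_commutator (Subgroup.mem_top g) hd))
  · have := normal_of_isCoatom_of_not_isAbnormal hM hA
    exact commutator_mem_of_isCoatom_of_normal hM g d

theorem isCoatom_map_of_ker_le {G Q : Type*} [Group G] [Group Q] {f : G →* Q}
    (hf : Function.Surjective f) {M : Subgroup G} (hker : f.ker ≤ M) (hM : IsCoatom M) :
    IsCoatom (M.map f) := by
  have hcomap : (M.map f).comap f = M := Subgroup.comap_map_eq_self hker
  refine ⟨fun h => hM.1 ?_, fun K hK => ?_⟩
  · rw [← hcomap, h, Subgroup.comap_top]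
  · apply Subgroup.comap_injective hf
    rw [Subgroup.comap_top]
    apply hM.2
    rw [← hcomap]
    exact (Subgroup.comap_lt_comap_of_surjective hf).2 hK

/-- Members of `S` contain N, so their images are maximal in G/N, and these images already intersect
trivially. -/
theorem frattini_quotient_eq_bot {G : Type*} [Group G] {N : Subgroup G} [N.Normal]
    {S : Set (Subgroup G)} (hS : ∀ M ∈ S, IsCoatom M) (hN : N = sInf S) :
    frattini (G ⧸ N) = ⊥ := by
  rw [eq_bot_iff]
  intro x hx
  obtain ⟨g, rfl⟩ := QuotientGroup.mk'_surjective N x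
  rw [Subgroup.mem_bot, QuotientGroup.mk'_apply, QuotientGroup.eq_one_iff]
  have key : ∀ M ∈ S, g ∈ M := by
    intro M hM
    have hNM : (QuotientGroup.mk' N).ker ≤ M := by
      rw [QuotientGroup.ker_mk', hN]
      exact sInf_le hM
    have hcomap : (M.map (QuotientGroup.mk' N)).comap (QuotientGroup.mk' N) = M :=
      Subgroup.comap_map_eq_self hNM
    have hc : IsCoatom (M.map (QuotientGroup.mk' N)) :=
      isCoatom_map_of_ker_le (QuotientGroup.mk'_surjective N) hNM (hS M hM)
    rw [← hcomap]
    exact frattini_le_coatom hc hx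
  rw [hN]
  exact Subgroup.mem_sInf.2 key

theorem frattini_quotient_frattini (G : Type*) [Group G] : frattini (G ⧸ frattini G) = ⊥ :=
  frattini_quotient_eq_bot (S := {M | IsCoatom M}) (fun _ h => h) sInf_eq_iInf.symm

theorem frattini_quotient_delta (G : Type*) [Group G] : frattini (G ⧸ delta G) = ⊥ :=
  frattini_quotient_eq_bot (S := {M | IsCoatom M ∧ IsAbnormal M}) (fun _ h => h.1) rfl

theorem frattini_le_delta (G : Type*) [Group G] : frattini G ≤ delta G :=
  le_sInf fun _ h => frattini_le_coatom h.1

theorem tildeFDelta_eq_tildeF (G : Type*) [Group G] [Finite G] : tildeFDelta G = tildeF G := by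
  let f : G ⧸ frattini G →* G ⧸ delta G :=
    QuotientGroup.map (frattini G) (delta G) (MonoidHom.id G) (frattini_le_delta G)
  have hcomp : f.comp (QuotientGroup.mk' (frattini G)) = QuotientGroup.mk' (delta G) := rfl
  have hf : Function.Surjective f := fun y => by
    obtain ⟨g, rfl⟩ := QuotientGroup.mk'_surjective (delta G) y
    exact ⟨QuotientGroup.mk' (frattini G) g, rfl⟩
  have hker : f.ker ≤ Subgroup.center (G ⧸ frattini G) := by
    intro x hx
    obtain ⟨d, rfl⟩ := QuotientGroup.mk'_surjective (frattini G) x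
    have hd : d ∈ delta G := (QuotientGroup.eq_one_iff d).1 hx
    rw [Subgroup.mem_center_iff]
    intro y
    obtain ⟨g, rfl⟩ := QuotientGroup.mk'_surjective (frattini G) y
    rw [← commutatorElement_eq_one_iff_mul_comm, ← map_commutatorElement]
    exact (QuotientGroup.eq_one_iff _).2 (commutator_mem_frattini hd g)
  rw [tildeFDelta, tildeF, socleMod, socleMod,
    ← comap_socle_of_ker_le_center (frattini_quotient_frattini G) hf hker,
    Subgroup.comap_comap, hcomp]

theorem tildeF_eq_socle {G : Type*} [Group G] [Finite G] (hG : frattini G = ⊥) :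
    tildeF G = socle G := by
  refine comap_socle_of_ker_le_center hG (QuotientGroup.mk'_surjective _) ?_
  rw [QuotientGroup.ker_mk', hG]
  exact bot_le

end GenFitting

theorem proposition3p6 (G : Type*) [Group G] [Finite G] :
    GenFitting.delta G ≤ GenFitting.tildeF G ∧
    GenFitting.tildeF (G ⧸ GenFitting.delta G) =
      (GenFitting.tildeF G).map (QuotientGroup.mk' (GenFitting.delta G)) ∧
    GenFitting.tildeFDelta G = GenFitting.tildeF G := by
  have h := GenFitting.tildeFDelta_eq_tildeF G
  refine ⟨?_, ?_, h⟩
  · rw [← h, GenFitting.tildeFDelta, GenFitting.socleMod]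
    exact (QuotientGroup.ker_mk' (GenFitting.delta G)).ge.trans (MonoidHom.ker_le_comap _ _)
  · rw [← h, GenFitting.tildeF_eq_socle (GenFitting.frattini_quotient_delta G),
      GenFitting.tildeFDelta, GenFitting.socleMod,
      Subgroup.map_comap_eq_self_of_surjective (QuotientGroup.mk'_surjective _)]
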